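/- Let $H_2(-,\mathbb{Z})\colon \mathrm{Groups}\to \mathrm{Ab}$ be the functor that sends a group $G$ to its second homology group with coefficients in the trivial $G$-module $\mathbb{Z}$. The natural transformations $\eta\colon H_2(-,\mathbb{Z})\to H_2(-,\mathbb{Z})$ are exactly the multiplications by integers: for every such $\eta$ there is an integer $n$ such that $\eta_G(x)=nx$ for all groups $G$ and all $x\in H_2(G,\mathbb{Z})$; and conversely, for every integer $n$, the maps $x\mapsto nx$ on $H_2(G,\mathbb{Z})$ form a natural transformation. -/

import Mathlib

open CategoryTheory

universe u

/-- The trivial `G`-module `ℤ`. Mathlib's group homology wants the coefficient ring in the universe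
of the group, so the ring of integers enters as its copy `ULift.{u} ℤ`. -/
noncomputable abbrev trivialInt (G : Type u) [Group G] : Rep.{u} (ULift.{u} ℤ) G :=
  Rep.trivial (ULift.{u} ℤ) G (ULift.{u} ℤ)

/-- A group homomorphism `f : G →* H` gives the identity map of `ℤ` as a morphism of `G`-modules
from the trivial module to the restriction along `f` of the trivial module. -/
noncomputable def trivialIntMap {G H : Type u} [Group G] [Group H] (f : G →* H) :
    trivialInt G ⟶ Rep.res f (trivialInt H) :=
  Rep.ofHom ⟨LinearMap.id, fun _ => rfl⟩

/-- The functor `H_n(-, ℤ)` from groups to abelian groups: `G` is sent to the additive group of the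
`n`-th group homology of `G` with coefficients in the trivial module `ℤ`, and `f : G ⟶ H` to the
map induced by `(g₁, …, gₙ) ↦ (f g₁, …, f gₙ)` on inhomogeneous chains. -/
noncomputable def integralHomology (n : ℕ) : GrpCat.{u} ⥤ AddCommGrpCat.{u} where
  obj G := (forget₂ (ModuleCat.{u} (ULift.{u} ℤ)) AddCommGrpCat.{u}).obj
    (groupHomology (trivialInt G) n)
  map f := (forget₂ (ModuleCat.{u} (ULift.{u} ℤ)) AddCommGrpCat.{u}).map
    (groupHomology.map f.hom (trivialIntMap f.hom) n)
  map_id G := by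
    rw [← CategoryTheory.Functor.map_id]
    exact congrArg _ (groupHomology.map_id (A := trivialInt G) n)
  map_comp f g := by
    rw [← CategoryTheory.Functor.map_comp]
    exact congrArg _ (groupHomology.map_comp f.hom g.hom (trivialIntMap f.hom)
      (trivialIntMap g.hom) n)

/-! Write T for ℤ × ℤ. Every class x in H₂(G) is the image of a class v generating H₂(P), where P is
a one-relator group, and some P → T sends the same v to the fundamental class τ of T. Naturality
then gives one integer k with η(v) = kv, η(x) = kx and η(τ) = kτ; since τ has infinite order, k does
not depend on x (`exists_torus_class`).

To find P, let E be the central extension of G by C₂/B₂ with the tautological cocycle. Its kernel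
meets [E, E] exactly in ker d = H₂(G) (`mem_commutator_iff`), so x is the value of a word w₀ in the
commutator subgroup of a free group. With two new letters a, b, put w = w₀[a, b] and let w be the
relator of P. Killing a, b gives P → G; killing the old letters gives P → T. The relator generates
H₂(P) (`exists_generator`), as in Hopf's formula. -/

/-- The cokernel of `∂ : C₃(G, ℤ) → C₂(G, ℤ)`. -/
abbrev ChainQuotient (G : Type u) [Group G] : Type u :=
  (G × G →₀ ULift.{u} ℤ) ⧸ groupHomology.boundaries₂ (trivialInt G)

/-! ### Two-chains modulo boundaries -/

namespace ChainQuotient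

section Basic

variable {G H : Type u} [Group G] [Group H]

/-- The class of a `2`-chain modulo boundaries. -/
noncomputable def mk : (G × G →₀ ULift.{u} ℤ) →ₗ[ULift.{u} ℤ] ChainQuotient G :=
  Submodule.mkQ (groupHomology.boundaries₂ (trivialInt G))

/-- The class of the generator `[g|h]`. -/
noncomputable def bar (g h : G) : ChainQuotient G := mk (Finsupp.single (g, h) 1)

lemma mk_surjective : Function.Surjective (mk (G := G)) :=
  Submodule.mkQ_surjective _

lemma mk_eq_zero_iff (c : G × G →₀ ULift.{u} ℤ) :
    mk c = 0 ↔ c ∈ groupHomology.boundaries₂ (trivialInt G) :=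
  Submodule.Quotient.mk_eq_zero _

lemma bar_add_bar (g h j : G) : bar g h + bar (g * h) j = bar h j + bar g (h * j) := by
  have hz : mk (groupHomology.d₃₂ (trivialInt G) (Finsupp.single (g, h, j) 1)) = 0 :=
    (mk_eq_zero_iff _).2 ⟨_, rfl⟩
  have e := groupHomology.d₃₂_single (A := trivialInt G) (g, h, j) 1
  rw [e] at hz
  simp only [Representation.isTrivial_def, map_sub, map_add] at hz
  change bar h j - bar (g * h) j + bar g (h * j) - bar g h = 0 at hz
  rw [sub_eq_zero] at hz
  rw [← hz]
  abel

lemma bar_one_left (g : G) : bar 1 g = bar (1 : G) 1 := by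
  have h := bar_add_bar 1 1 g
  simp only [one_mul] at h
  exact (add_right_cancel h).symm

lemma bar_one_right (g : G) : bar g 1 = bar (1 : G) 1 := by
  have h := bar_add_bar g 1 1
  simp only [mul_one] at h
  exact add_right_cancel h

lemma addMonoidHom_ext {A : Type*} [AddCommGroup A] {f g : ChainQuotient G →+ A}
    (h : ∀ a b, f (bar a b) = g (bar a b)) : f = g := by
  ext q
  obtain ⟨c, rfl⟩ := mk_surjective q
  induction c using Finsupp.induction_linear with
  | zero => simp
  | add c d hc hd => simp [hc, hd]
  | single p n =>
    have : Finsupp.single p n = n.down • (Finsupp.single p 1 : G × G →₀ ULift.{u} ℤ) := by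
      rw [Finsupp.smul_single]
      congr 1
      ext
      simp
    rw [this, map_zsmul, map_zsmul, map_zsmul]
    exact congrArg _ (h p.1 p.2)

/-- The differential `C₂(G, ℤ) / B₂(G, ℤ) → C₁(G, ℤ)`. -/
noncomputable def d : ChainQuotient G →ₗ[ULift.{u} ℤ] (G →₀ ULift.{u} ℤ) :=
  Submodule.liftQ _ (groupHomology.d₂₁ (trivialInt G)).hom
    (groupHomology.boundaries₂_le_cycles₂ (trivialInt G))

lemma d_bar (g h : G) :
    d (bar g h) = Finsupp.single h 1 - Finsupp.single (g * h) 1 + Finsupp.single g 1 :=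
  groupHomology.d₂₁_single (A := trivialInt G) (g, h) 1

lemma chainsMap₂_trivialIntMap (f : G →* H) (c : G × G →₀ ULift.{u} ℤ) :
    groupHomology.chainsMap₂ f (trivialIntMap f) c = Finsupp.mapDomain (Prod.map f f) c :=
  Finsupp.mapRange_id _

lemma boundaries₂_le_comap_lmapDomain (f : G →* H) :
    groupHomology.boundaries₂ (trivialInt G) ≤ (groupHomology.boundaries₂ (trivialInt H)).comap
      (Finsupp.lmapDomain (ULift.{u} ℤ) (ULift.{u} ℤ) (Prod.map f f)) := by
  rintro _ ⟨c, rfl⟩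
  have h := congr($((groupHomology.mapShortComplexH2 f (trivialIntMap f)).comm₁₂) c)
  exact ⟨_, h.trans (chainsMap₂_trivialIntMap f _)⟩

/-- The map `C₂(G, ℤ) / B₂(G, ℤ) → C₂(H, ℤ) / B₂(H, ℤ)` induced by a homomorphism. -/
noncomputable def map (f : G →* H) : ChainQuotient G →ₗ[ULift.{u} ℤ] ChainQuotient H :=
  Submodule.mapQ _ _ (Finsupp.lmapDomain (ULift.{u} ℤ) (ULift.{u} ℤ) (Prod.map f f))
    (boundaries₂_le_comap_lmapDomain f)

lemma map_mk (f : G →* H) (c : G × G →₀ ULift.{u} ℤ) :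
    map f (mk c) = mk (Finsupp.mapDomain (Prod.map f f) c) := rfl

lemma map_bar (f : G →* H) (a b : G) : map f (bar a b) = bar (f a) (f b) := by
  simp [bar, map_mk, Finsupp.mapDomain_single]

end Basic

end ChainQuotient

open ChainQuotient

/-! ### H₂ as the kernel of the differential on C₂/B₂ -/

/-- A class in `H₂(G, ℤ)` and a class in `C₂(G, ℤ) / B₂(G, ℤ)` are represented by the same
cycle. -/
def Represents {G : GrpCat.{u}} (x : (integralHomology.{u} 2).obj G) (q : ChainQuotient G) : Prop :=
  ∃ z : groupHomology.cycles₂ (trivialInt G), groupHomology.H2π (trivialInt G) z = x ∧ mk z.1 = q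

namespace Represents

variable {G H : GrpCat.{u}} {x y : (integralHomology.{u} 2).obj G} {q r : ChainQuotient G}

lemma exists_right (x : (integralHomology.{u} 2).obj G) : ∃ q, Represents x q ∧ d q = 0 := by
  obtain ⟨z, hz⟩ := (ModuleCat.epi_iff_surjective (groupHomology.H2π (trivialInt G))).1
    inferInstance x
  exact ⟨mk z.1, ⟨z, hz, rfl⟩, z.2⟩

lemma exists_left (hq : d q = 0) : ∃ x, Represents x q := by
  obtain ⟨c, rfl⟩ := mk_surjective q
  exact ⟨_, ⟨c, hq⟩, rfl, rfl⟩

lemma add (hx : Represents x q) (hy : Represents y r) : Represents (x + y) (q + r) := by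
  obtain ⟨z, rfl, rfl⟩ := hx
  obtain ⟨w, rfl, rfl⟩ := hy
  exact ⟨z + w, map_add (groupHomology.H2π (trivialInt G)).hom z w, map_add mk z.1 w.1⟩

lemma zsmul (n : ℤ) (hx : Represents x q) : Represents (n • x) (n • q) := by
  obtain ⟨z, rfl, rfl⟩ := hx
  exact ⟨n • z, map_zsmul (groupHomology.H2π (trivialInt G)).hom n z, map_zsmul mk n z.1⟩

lemma eq_zero_iff (hx : Represents x q) : x = 0 ↔ q = 0 := by
  obtain ⟨z, rfl, rfl⟩ := hx
  rw [mk_eq_zero_iff]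
  exact groupHomology.H2π_eq_zero_iff z

lemma eq_iff (hx : Represents x q) (hy : Represents y r) : x = y ↔ q = r := by
  have h := (hx.add (hy.zsmul (-1))).eq_zero_iff
  rwa [neg_one_zsmul, neg_one_zsmul, ← sub_eq_add_neg, ← sub_eq_add_neg, sub_eq_zero,
    sub_eq_zero] at h

lemma map (f : G ⟶ H) (hx : Represents x q) :
    Represents ((integralHomology.{u} 2).map f x) (ChainQuotient.map f.hom q) := by
  obtain ⟨z, rfl, rfl⟩ := hx
  refine ⟨groupHomology.mapCycles₂ f.hom (trivialIntMap f.hom) z, ?_, ?_⟩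
  · exact (groupHomology.H2π_comp_map_apply f.hom (trivialIntMap f.hom) z).symm
  · rw [map_mk]
    exact congrArg mk (chainsMap₂_trivialIntMap f.hom z.1)

end Represents

/-! ### The tautological central extension and its commutators -/

/-- The central extension of `G` by `C₂(G, ℤ) / B₂(G, ℤ)` with cocycle `(g, h) ↦ [g|h]`. -/
@[ext]
structure BarExtension (G : Type u) [Group G] : Type u where
  coeff : ChainQuotient G
  base : G

/-- Homomorphisms preserve the commutator subgroup. -/
lemma map_mem_commutator {G H : Type*} [Group G] [Group H] (f : G →* H) {g : G}
    (hg : g ∈ commutator G) : f g ∈ commutator H := by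
  have h := Subgroup.mem_map_of_mem f hg
  rw [map_commutator_eq] at h
  exact Subgroup.commutator_mono le_top le_top h

namespace BarExtension

open ChainQuotient
open scoped commutatorElement

section Basic

variable {G H : Type u} [Group G] [Group H]

noncomputable instance : Mul (BarExtension G) :=
  ⟨fun a b => ⟨a.coeff + b.coeff + bar a.base b.base, a.base * b.base⟩⟩

/-- The cocycle is not normalized, so the unit and `incl` are shifted by `bar 1 1`. -/
noncomputable instance : One (BarExtension G) := ⟨⟨-bar 1 1, 1⟩⟩

noncomputable instance : Inv (BarExtension G) :=
  ⟨fun a => ⟨-a.coeff - bar a.base⁻¹ a.base - bar 1 1, a.base⁻¹⟩⟩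

@[simp] lemma mul_coeff (a b : BarExtension G) :
    (a * b).coeff = a.coeff + b.coeff + bar a.base b.base := rfl

@[simp] lemma mul_base (a b : BarExtension G) : (a * b).base = a.base * b.base := rfl

@[simp] lemma one_coeff : (1 : BarExtension G).coeff = -bar 1 1 := rfl

@[simp] lemma one_base : (1 : BarExtension G).base = 1 := rfl

@[simp] lemma inv_coeff (a : BarExtension G) :
    a⁻¹.coeff = -a.coeff - bar a.base⁻¹ a.base - bar 1 1 := rfl

@[simp] lemma inv_base (a : BarExtension G) : a⁻¹.base = a.base⁻¹ := rfl

noncomputable instance : Group (BarExtension G) :=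
  Group.ofLeftAxioms
    (fun a b c => by
      ext1
      · have h := bar_add_bar a.base b.base c.base
        simp only [mul_coeff, mul_base]
        rw [← sub_eq_zero] at h ⊢
        rw [← h]
        abel
      · exact mul_assoc _ _ _)
    (fun a => by
      ext1
      · simp [bar_one_left a.base]
      · simp)
    (fun a => by
      ext1
      · simp only [mul_coeff, inv_coeff, inv_base, one_coeff]
        abel
      · simp)

/-- The projection of the extension onto `G`. -/
def proj : BarExtension G →* G where
  toFun := base
  map_one' := rfl
  map_mul' _ _ := rfl

/-- The inclusion of the kernel of the extension. -/
noncomputable def incl : Multiplicative (ChainQuotient G) →* BarExtension G where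
  toFun q := ⟨q.toAdd - bar 1 1, 1⟩
  map_one' := by ext1 <;> simp
  map_mul' q r := by
    ext1
    · simp only [mul_coeff, toAdd_mul]
      abel
    · simp

/-- The set-theoretic section `g ↦ (0, g)`. -/
noncomputable def sec (g : G) : BarExtension G := ⟨0, g⟩

@[simp] lemma proj_sec (g : G) : proj (sec g) = g := rfl

lemma incl_injective : Function.Injective (incl (G := G)) := fun _ _ h =>
  Multiplicative.toAdd.injective (sub_left_injective (congrArg coeff h))

@[simp] lemma proj_incl (q : Multiplicative (ChainQuotient G)) : proj (incl q) = 1 := rfl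

lemma incl_mul (q : Multiplicative (ChainQuotient G)) (a : BarExtension G) :
    incl q * a = ⟨q.toAdd + a.coeff, a.base⟩ := by
  ext1
  · change q.toAdd - bar 1 1 + a.coeff + bar 1 a.base = _
    rw [bar_one_left a.base, sub_add_eq_add_sub, sub_add_cancel]
  · exact one_mul _

lemma mul_incl (q : Multiplicative (ChainQuotient G)) (a : BarExtension G) :
    a * incl q = ⟨q.toAdd + a.coeff, a.base⟩ := by
  ext1
  · change a.coeff + (q.toAdd - bar 1 1) + bar a.base 1 = _
    rw [bar_one_right a.base, add_assoc, sub_add_cancel, add_comm]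
  · exact mul_one _

lemma incl_commute (q : Multiplicative (ChainQuotient G)) (a : BarExtension G) :
    Commute (incl q) a :=
  (incl_mul q a).trans (mul_incl q a).symm

lemma exists_incl_mul {a b : BarExtension G} (h : proj a = proj b) : ∃ q, a = incl q * b := by
  refine ⟨Multiplicative.ofAdd (a.coeff - b.coeff), ?_⟩
  rw [incl_mul]
  ext1
  · simp
  · exact h

lemma exists_incl {a : BarExtension G} (h : proj a = 1) : ∃ q, a = incl q := by
  obtain ⟨q, hq⟩ := exists_incl_mul (a := a) (b := 1) h
  exact ⟨q, by rw [hq, mul_one]⟩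

lemma sec_mul_sec (g h : G) :
    sec g * sec h = incl (Multiplicative.ofAdd (bar g h)) * sec (g * h) := by
  rw [incl_mul]
  ext1
  · simp [sec]
  · simp [sec]

/-- The kernel is central, so a commutator does not see the choice of lifts. -/
lemma commutatorElement_eq_of_proj_eq {a a' b b' : BarExtension G} (ha : proj a = proj a')
    (hb : proj b = proj b') : ⁅a, b⁆ = ⁅a', b'⁆ := by
  obtain ⟨q, rfl⟩ := exists_incl_mul ha
  obtain ⟨r, rfl⟩ := exists_incl_mul hb
  rw [commutatorElement_mul_left_eq_conj_mul, (incl_commute q _).commutator_eq,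
    (incl_commute q _).eq, mul_inv_cancel_right, mul_one, commutatorElement_mul_right_eq_mul_conj,
    (incl_commute r a').symm.commutator_eq, one_mul, (incl_commute r _).eq, mul_inv_cancel_right]

lemma map_eq_of_mem_commutator {F : Type*} [Group F] {φ ψ : F →* BarExtension G}
    (h : proj.comp φ = proj.comp ψ) {r : F} (hr : r ∈ commutator F) : φ r = ψ r := by
  have hle : commutator F ≤ φ.eqLocus ψ := by
    refine Subgroup.commutator_le.2 fun a _ b _ => ?_
    change φ ⁅a, b⁆ = ψ ⁅a, b⁆
    rw [map_commutatorElement, map_commutatorElement]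
    exact commutatorElement_eq_of_proj_eq (DFunLike.congr_fun h a) (DFunLike.congr_fun h b)
  exact hle hr

lemma commutator_le_map {F : Type*} [Group F] (φ : F →* BarExtension G)
    (h : Function.Surjective (proj.comp φ)) :
    commutator (BarExtension G) ≤ (commutator F).map φ := by
  refine Subgroup.commutator_le.2 fun a _ b _ => ?_
  obtain ⟨r, hr⟩ := h (proj a)
  obtain ⟨s, hs⟩ := h (proj b)
  refine ⟨⁅r, s⁆, Subgroup.commutator_mem_commutator trivial trivial, ?_⟩
  rw [map_commutatorElement]
  exact commutatorElement_eq_of_proj_eq hr hs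

/-- The homomorphism to the `1`-chains that extends the differential. -/
noncomputable def toOneChains : BarExtension G →* Multiplicative (G →₀ ULift.{u} ℤ) where
  toFun a := Multiplicative.ofAdd (d a.coeff + Finsupp.single a.base 1)
  map_one' := by
    rw [one_coeff, one_base, map_neg, d_bar]
    simp
  map_mul' a b := by
    rw [← ofAdd_add, mul_coeff, mul_base, map_add d, map_add d, d_bar]
    refine congrArg Multiplicative.ofAdd ?_
    abel

lemma toOneChains_incl (q : Multiplicative (ChainQuotient G)) :
    toOneChains (incl q) = Multiplicative.ofAdd (d q.toAdd) := by
  change Multiplicative.ofAdd (d (q.toAdd - bar 1 1) + Finsupp.single 1 1) = _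
  rw [map_sub, d_bar]
  simp

/-- `toOneChains` has abelian target and restricts to `d` on the kernel. -/
lemma d_eq_zero_of_mem_commutator {q : ChainQuotient G}
    (h : incl (Multiplicative.ofAdd q) ∈ commutator (BarExtension G)) : d q = 0 := by
  have h' := Abelianization.commutator_subset_ker toOneChains h
  rw [MonoidHom.mem_ker, toOneChains_incl] at h'
  exact h'

/-- The homomorphism from the `1`-chains to the abelianization that sends `[g]` to the class of
`(0, g)`. -/
noncomputable def ofOneChains : (G →₀ ULift.{u} ℤ) →+ Additive (Abelianization (BarExtension G)) :=
  Finsupp.liftAddHom fun g =>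
    ((zmultiplesHom _) (Additive.ofMul (Abelianization.of (sec g)))).comp
      AddEquiv.ulift.toAddMonoidHom

lemma ofOneChains_single (g : G) :
    ofOneChains (Finsupp.single g 1) = Additive.ofMul (Abelianization.of (sec g)) := by
  rw [ofOneChains, Finsupp.liftAddHom_apply_single]
  exact one_zsmul _

lemma ofOneChains_d (q : ChainQuotient G) :
    ofOneChains (d q) = Additive.ofMul (Abelianization.of (incl (Multiplicative.ofAdd q))) := by
  refine DFunLike.congr_fun (addMonoidHom_ext (f := ofOneChains.comp d.toAddMonoidHom)
    (g := (Abelianization.of.comp incl).toAdditiveRight) fun g h => ?_) q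
  have e := congrArg (fun a => Additive.ofMul (Abelianization.of a)) (sec_mul_sec g h)
  simp only [map_mul, ofMul_mul] at e
  change ofOneChains (d (bar g h)) = Additive.ofMul (Abelianization.of (incl _))
  rw [d_bar, map_add, map_sub, ofOneChains_single, ofOneChains_single, ofOneChains_single,
    sub_add_eq_add_sub, sub_eq_iff_eq_add, ← e, add_comm]

/-- Conversely, the map from the kernel to the abelianization factors through `d`, by
`ofOneChains_d`. -/
lemma mem_commutator_iff {q : ChainQuotient G} :
    incl (Multiplicative.ofAdd q) ∈ commutator (BarExtension G) ↔ d q = 0 := by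
  refine ⟨d_eq_zero_of_mem_commutator, fun h => ?_⟩
  have h' := ofOneChains_d q
  rw [h, map_zero] at h'
  rw [← Abelianization.ker_of, MonoidHom.mem_ker]
  exact h'.symm

/-- The homomorphism of extensions induced by a group homomorphism. -/
noncomputable def map (f : G →* H) : BarExtension G →* BarExtension H where
  toFun a := ⟨ChainQuotient.map f a.coeff, f a.base⟩
  map_one' := by ext1 <;> simp [map_bar]
  map_mul' a b := by ext1 <;> simp [map_bar]

lemma map_incl (f : G →* H) (q : ChainQuotient G) :
    map f (incl (Multiplicative.ofAdd q)) =
      incl (Multiplicative.ofAdd (ChainQuotient.map f q)) := by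
  ext1
  · change ChainQuotient.map f (q - bar 1 1) = ChainQuotient.map f q - bar 1 1
    rw [map_sub, map_bar, map_one]
  · exact map_one f

end Basic

/-! ### One-relator groups with relator in the commutator subgroup -/

section OneRelator

variable {α : Type u}

/-- The homomorphism from a free group to the extension of a quotient, `xᵢ ↦ (0, xᵢ)`. -/
noncomputable def ofFree (w : FreeGroup α) :
    FreeGroup α →* BarExtension (PresentedGroup {w}) :=
  FreeGroup.lift fun i => sec (PresentedGroup.of i)

lemma proj_comp_ofFree (w : FreeGroup α) :
    proj.comp (ofFree w) = PresentedGroup.mk {w} := by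
  ext i
  simp [ofFree]
  rfl

/-- The class of the relator of a one-relator group generates the kernel of the differential. -/
lemma exists_generator {w : FreeGroup α} (hw : w ∈ commutator (FreeGroup α)) :
    ∃ v : ChainQuotient (PresentedGroup {w}), d v = 0 ∧
      ofFree w w = incl (Multiplicative.ofAdd v) ∧
      ∀ u : ChainQuotient (PresentedGroup {w}), d u = 0 → ∃ k : ℤ, u = k • v := by
  have hproj (r : FreeGroup α) : proj (ofFree w r) = PresentedGroup.mk {w} r :=
    DFunLike.congr_fun (proj_comp_ofFree w) r
  obtain ⟨v, hv⟩ := exists_incl (a := ofFree w w) <| by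
    rw [hproj]
    exact PresentedGroup.one_of_mem rfl
  refine ⟨v.toAdd, mem_commutator_iff.1 ?_, hv, fun u hu => ?_⟩
  · rw [ofAdd_toAdd, ← hv]
    exact map_mem_commutator (ofFree w) hw
  · obtain ⟨r, -, hr⟩ := commutator_le_map (ofFree w)
      (by rw [proj_comp_ofFree]; exact PresentedGroup.mk_surjective _) (mem_commutator_iff.2 hu)
    -- The image of the normal closure of `w` is cyclic, because `w` maps to the central element
    -- `incl v`.
    have hnormal : (Subgroup.zpowers (incl v)).Normal := by
      refine ⟨fun n hn g => ?_⟩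
      obtain ⟨k, rfl⟩ := hn
      change g * incl v ^ k * g⁻¹ ∈ _
      rw [← ((incl_commute v g).zpow_left k).eq, mul_inv_cancel_right]
      exact ⟨k, rfl⟩
    have hle : Subgroup.normalClosure {w} ≤ (Subgroup.zpowers (incl v)).comap (ofFree w) :=
      Subgroup.normalClosure_le_normal (by
        rintro _ rfl
        exact ⟨1, (zpow_one _).trans hv.symm⟩)
    have hmem : r ∈ Subgroup.normalClosure {w} := by
      refine (QuotientGroup.eq_one_iff r).1 ((hproj r).symm.trans ?_)
      rw [hr]
      rfl
    obtain ⟨k, hk⟩ := hle hmem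
    refine ⟨k, ?_⟩
    change incl v ^ k = _ at hk
    rw [hr, ← map_zpow] at hk
    exact (congrArg Multiplicative.toAdd (incl_injective hk)).symm

end OneRelator

end BarExtension

open BarExtension
open scoped commutatorElement

/-! ### The torus class has infinite order -/

/-- The group `ℤ × ℤ`, written multiplicatively. -/
abbrev IntTorus : Type u := Multiplicative (ULift.{u} (ℤ × ℤ))

namespace IntTorus

/-- The element `(m, n)` of `ℤ × ℤ`. -/
def pair (m n : ℤ) : IntTorus.{u} := Multiplicative.ofAdd ⟨(m, n)⟩

/-- The fundamental class of the torus, as a class in `C₂ / B₂`. -/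
noncomputable def bracket : ChainQuotient IntTorus.{u} :=
  bar (pair 1 0) (pair 0 1) - bar (pair 0 1) (pair 1 0)

lemma commutatorElement_sec :
    ⁅sec (pair.{u} 1 0), sec (pair 0 1)⁆ = incl (Multiplicative.ofAdd bracket) := by
  rw [commutatorElement_def, mul_assoc, ← mul_inv_rev, mul_inv_eq_iff_eq_mul, sec_mul_sec,
    sec_mul_sec, ← mul_assoc, ← map_mul, ← ofAdd_add, bracket, sub_add_cancel, mul_comm (pair 0 1)]

lemma d_bracket : d bracket.{u} = 0 :=
  mem_commutator_iff.1 (commutatorElement_sec ▸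
    Subgroup.commutator_mem_commutator (Subgroup.mem_top _) (Subgroup.mem_top _))

/-- The cochain `((a, b), (a', b')) ↦ a b'`, on `2`-chains. -/
noncomputable def cupChain : (IntTorus.{u} × IntTorus.{u} →₀ ULift.{u} ℤ) →ₗ[ULift.{u} ℤ]
    ULift.{u} ℤ :=
  Finsupp.linearCombination _ fun p => ⟨p.1.toAdd.down.1 * p.2.toAdd.down.2⟩

lemma cupChain_single (g h : IntTorus.{u}) (n : ULift.{u} ℤ) :
    cupChain (Finsupp.single (g, h) n) = ⟨n.down * (g.toAdd.down.1 * h.toAdd.down.2)⟩ := by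
  rw [cupChain, Finsupp.linearCombination_single]
  rfl

/-- A bilinear function of two group elements is a 2-cocycle. -/
lemma boundaries₂_le_ker_cupChain :
    groupHomology.boundaries₂ (trivialInt IntTorus.{u}) ≤ LinearMap.ker cupChain := by
  rintro _ ⟨c, rfl⟩
  induction c using Finsupp.induction_linear with
  | zero => simp
  | add c c' hc hc' =>
    rw [map_add]
    exact add_mem hc hc'
  | single p n =>
    have e := groupHomology.d₃₂_single (A := trivialInt IntTorus.{u}) p n
    rw [LinearMap.mem_ker]
    refine (congrArg cupChain e).trans ?_
    change cupChain (Finsupp.single (p.2.1, p.2.2) n - Finsupp.single (p.1 * p.2.1, p.2.2) n +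
      Finsupp.single (p.1, p.2.1 * p.2.2) n - Finsupp.single (p.1, p.2.1) n) = 0
    simp only [map_sub, map_add, cupChain_single]
    ext
    simp only [ULift.sub_down, ULift.add_down, toAdd_mul, Prod.fst_add, Prod.snd_add,
      ULift.zero_down]
    ring

/-- The cup product pairing on `C₂ / B₂`. -/
noncomputable def cup : ChainQuotient IntTorus.{u} →ₗ[ULift.{u} ℤ] ULift.{u} ℤ :=
  Submodule.liftQ _ cupChain boundaries₂_le_ker_cupChain

lemma cup_bar (g h : IntTorus.{u}) :
    cup (bar g h) = ⟨g.toAdd.down.1 * h.toAdd.down.2⟩ :=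
  (cupChain_single g h 1).trans (by simp)

lemma cup_bracket : cup bracket.{u} = 1 := by
  rw [bracket, map_sub, cup_bar, cup_bar]
  ext
  simp [pair]

lemma zsmul_bracket_injective : Function.Injective fun n : ℤ => n • bracket.{u} := by
  intro m n h
  have h' := congrArg (fun q => (cup q).down) h
  simpa [map_zsmul, cup_bracket] using h'

end IntTorus

/-! ### The universal one-relator group -/

/-- Every class in the kernel of the differential is the image of a class `v` of some group `P`,
where `v` generates the kernel of the differential of `P` and maps to the class of the torus. -/
lemma ChainQuotient.exists_universal {G : Type u} [Group G] {q : ChainQuotient G} (hq : d q = 0) :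
    ∃ (P : Type u) (_ : Group P) (v : ChainQuotient P) (f : P →* G) (t : P →* IntTorus.{u}),
      d v = 0 ∧ map f v = q ∧ map t v = IntTorus.bracket ∧
        ∀ u : ChainQuotient P, d u = 0 → ∃ k : ℤ, u = k • v := by
  let φ₀ : FreeGroup (BarExtension G) →* BarExtension G := FreeGroup.lift id
  have hφ₀ : Function.Surjective φ₀ := fun a => ⟨FreeGroup.of a, FreeGroup.lift_apply_of⟩
  have hmem := mem_commutator_iff.2 hq
  rw [commutator_def, ← Subgroup.map_top_of_surjective φ₀ hφ₀, ← Subgroup.map_commutator] at hmem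
  obtain ⟨w₀, hw₀, hφw₀⟩ := hmem
  let x (b : Bool) : FreeGroup (BarExtension G ⊕ Bool) := FreeGroup.of (Sum.inr b)
  -- The extra commutator makes the relator hit the torus class; `φ` kills it and `ρ` kills `w₀`.
  let w : FreeGroup (BarExtension G ⊕ Bool) := FreeGroup.map Sum.inl w₀ * ⁅x true, x false⁆
  have hw : w ∈ commutator (FreeGroup (BarExtension G ⊕ Bool)) :=
    mul_mem (map_mem_commutator _ hw₀)
      (Subgroup.commutator_mem_commutator (Subgroup.mem_top _) (Subgroup.mem_top _))
  obtain ⟨v, hv, hwv, hgen⟩ := exists_generator hw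
  have key {K : Type u} [Group K] (ψ : FreeGroup (BarExtension G ⊕ Bool) →* BarExtension K)
      {r : ChainQuotient K} (hψ : ψ w = incl (Multiplicative.ofAdd r)) :
      ∃ f : PresentedGroup {w} →* K, map f v = r := by
    let f : PresentedGroup {w} →* K :=
      QuotientGroup.lift _ (proj.comp ψ) (Subgroup.normalClosure_le_normal (by
        rintro _ rfl
        change proj (ψ w) = 1
        rw [hψ, proj_incl]))
    refine ⟨f, Multiplicative.ofAdd.injective (incl_injective ?_)⟩
    rw [← map_incl, ← hwv, ← hψ]
    -- Both homomorphisms lift the same map to `K`, so they agree on `w`.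
    refine map_eq_of_mem_commutator (φ := (BarExtension.map f).comp (ofFree w)) ?_ hw
    exact MonoidHom.ext fun r => congrArg f (DFunLike.congr_fun (proj_comp_ofFree w) r)
  let φ : FreeGroup (BarExtension G ⊕ Bool) →* BarExtension G :=
    FreeGroup.lift (Sum.elim id fun _ => 1)
  have hφ : φ w = incl (Multiplicative.ofAdd q) := by
    have e : φ.comp (FreeGroup.map Sum.inl) = φ₀ := by
      refine FreeGroup.ext_hom _ _ fun a => ?_
      simp [φ, φ₀]
    have hx (b : Bool) : φ (x b) = 1 := FreeGroup.lift_apply_of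
    rw [map_mul, map_commutatorElement, hx, hx, commutatorElement_one_left, mul_one, ← hφw₀, ← e]
    rfl
  let ρ : FreeGroup (BarExtension G ⊕ Bool) →* BarExtension IntTorus.{u} :=
    FreeGroup.lift (Sum.elim (fun _ => 1) fun b =>
      sec (if b then IntTorus.pair 1 0 else IntTorus.pair 0 1))
  have hρ : ρ w = incl (Multiplicative.ofAdd IntTorus.bracket) := by
    have e : ρ.comp (FreeGroup.map Sum.inl) = 1 := by
      refine FreeGroup.ext_hom _ _ fun a => ?_
      simp [ρ]
    have hx (b : Bool) : ρ (x b) = sec (if b then IntTorus.pair 1 0 else IntTorus.pair 0 1) :=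
      FreeGroup.lift_apply_of
    rw [map_mul, map_commutatorElement, hx, hx, ← IntTorus.commutatorElement_sec]
    exact mul_eq_right.2 (DFunLike.congr_fun e w₀)
  obtain ⟨f, hf⟩ := key φ hφ
  obtain ⟨t, ht⟩ := key ρ hρ
  exact ⟨_, _, v, f, t, hv, hf, ht, hgen⟩

/-- The fundamental class of the torus. -/
lemma exists_torus_class : ∃ τ : (integralHomology.{u} 2).obj (GrpCat.of IntTorus.{u}),
    (∀ m n : ℤ, m • τ = n • τ → m = n) ∧
    ∀ (G : GrpCat.{u}) (x : (integralHomology.{u} 2).obj G),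
      ∃ (P : GrpCat.{u}) (v : (integralHomology.{u} 2).obj P) (f : P ⟶ G)
        (t : P ⟶ GrpCat.of IntTorus.{u}),
        (integralHomology.{u} 2).map f v = x ∧ (integralHomology.{u} 2).map t v = τ ∧
          ∀ y : (integralHomology.{u} 2).obj P, ∃ k : ℤ, y = k • v := by
  obtain ⟨τ, hτ⟩ := Represents.exists_left (G := GrpCat.of IntTorus.{u}) IntTorus.d_bracket
  refine ⟨τ, fun m n h => ?_, fun G x => ?_⟩
  · exact IntTorus.zsmul_bracket_injective (((hτ.zsmul m).eq_iff (hτ.zsmul n)).1 h)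
  · obtain ⟨q, hxq, hq⟩ := Represents.exists_right x
    obtain ⟨P, _, v, f, t, hv, hf, ht, hgen⟩ := exists_universal hq
    obtain ⟨y, hy⟩ := Represents.exists_left (G := GrpCat.of P) hv
    refine ⟨GrpCat.of P, y, GrpCat.ofHom f, GrpCat.ofHom t, ((hy.map _).eq_iff hxq).2 hf,
      ((hy.map _).eq_iff hτ).2 ht, fun z => ?_⟩
    obtain ⟨r, hzr, hr⟩ := Represents.exists_right z
    obtain ⟨k, hk⟩ := hgen r hr
    exact ⟨k, (hzr.eq_iff (hy.zsmul k)).2 hk⟩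

theorem mainTheorem10 :
    (∀ η : integralHomology.{u} 2 ⟶ integralHomology.{u} 2,
      ∃ n : ℤ, ∀ (G : GrpCat.{u}) (x : (integralHomology.{u} 2).obj G), η.app G x = n • x) ∧
    (∀ n : ℤ, ∃ η : integralHomology.{u} 2 ⟶ integralHomology.{u} 2,
      ∀ (G : GrpCat.{u}) (x : (integralHomology.{u} 2).obj G), η.app G x = n • x) := by
  refine ⟨fun η => ?_, fun n => ⟨n • 𝟙 _, fun G x => ?_⟩⟩
  · obtain ⟨τ, hτ, huniv⟩ := exists_torus_class.{u}
    have key (G : GrpCat.{u}) (x : (integralHomology.{u} 2).obj G) :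
        ∃ k : ℤ, η.app G x = k • x ∧ η.app _ τ = k • τ := by
      obtain ⟨P, v, f, t, rfl, ht, hgen⟩ := huniv G x
      obtain ⟨k, hk⟩ := hgen (η.app P v)
      refine ⟨k, ?_, ?_⟩
      · rw [NatTrans.naturality_apply, hk, map_zsmul]
      · rw [← ht, NatTrans.naturality_apply, hk, map_zsmul]
    -- The integer is read off from the action of `η` on `τ`.
    obtain ⟨n, hn, -⟩ := key _ τ
    refine ⟨n, fun G x => ?_⟩
    obtain ⟨k, hx, hk⟩ := key G x
    rw [hx, hτ k n (hk.symm.trans hn)]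
  · rw [NatTrans.app_zsmul]
    rfl
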